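/- Let $X$ be a (real or complex) Banach space and let $A$ be an injective linear operator on $X$ with domain $D(A)$ and dense range which generates a bounded $C_0$-semigroup $(T(t))_{t\ge 0}$ on $X$. Let $(\varepsilon_n)_{n\in\mathbb N}\subset(0,\infty)$ with $\varepsilon_n\to 0$. For $t\ge 0$ and $s>0$ put $$b_t(s) = -\sqrt t\,\frac{J_1(2\sqrt{ts})}{\sqrt s},\qquad J_1(x)=\sum_{m=0}^\infty \frac{(-1)^m}{m!\,(m+1)!}\Big(\frac x2\Big)^{2m+1}.$$ Then for all $n\in\mathbb N$ and $t\ge 0$ the operator $A-\varepsilon_n$ has a bounded everywhere defined inverse $(A-\varepsilon_n)^{-1}$, and $$B_n(t)x=\int_0^\infty b_t(s)\,e^{-\varepsilon_n s}\,T(s)x\,ds\qquad(x\in X)$$ converges absolutely for every $x$ and defines a bounded linear operator $B_n(t)$ on $X$. Moreover, the following are equivalent. (i) For every compact $K\subset[0,\infty)$ one has $\sup_{n\in\mathbb N,\,t\in K}\|B_n(t)\|<\infty$. (ii) For every $x\in X$ the sequence of functions $t\mapsto e^{t(A-\varepsilon_n)^{-1}}x$, $n\in\mathbb N$, converges uniformly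 on compact subsets of $[0,\infty)$. If (i) or (ii) holds, then $S(t)x=\lim_{n\to\infty}e^{t(A-\varepsilon_n)^{-1}}x$ $(t\ge 0,\ x\in X)$ defines a $C_0$-semigroup on $X$ whose generator is $A^{-1}$ (with domain the range of $A$). -/

import Mathlib

open Set Filter Topology MeasureTheory

/-- The Bessel function of the first kind of order `k : ℕ`,
`J_k(x) = ∑ₘ (-1)ᵐ / (m! (m + k)!) (x / 2) ^ (2 m + k)`. -/
noncomputable def besselJ (k : ℕ) (x : ℝ) : ℝ :=
  ∑' m : ℕ, (-1) ^ m / ((m.factorial : ℝ) * ((m + k).factorial : ℝ)) * (x / 2) ^ (2 * m + k)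

/-- The kernel `b_t(s) = -√t J₁(2 √(t s)) / √s`, for `t ≥ 0` and `s > 0`. -/
noncomputable def besselKernel (t s : ℝ) : ℝ :=
  -(√t * (besselJ 1 (2 * √(t * s)) / √s))

section Semigroups

variable {𝕜 X : Type*} [RCLike 𝕜] [NormedAddCommGroup X] [NormedSpace 𝕜 X]

/-- `(T t)_{t ≥ 0}` is a strongly continuous (`C₀`-) semigroup of bounded operators on `X`.
The values `T t` at `t < 0` are irrelevant. -/
structure IsC0Semigroup (T : ℝ → X →L[𝕜] X) : Prop where
  map_zero : T 0 = 1
  map_add : ∀ s t : ℝ, 0 ≤ s → 0 ≤ t → T (s + t) = T s * T t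
  strongly_continuous : ∀ x : X, ContinuousOn (fun t => T t x) (Ici 0)

/-- The semigroup is bounded: `sup_{t ≥ 0} ‖T t‖ < ∞`. -/
def IsBoundedSemigroup (T : ℝ → X →L[𝕜] X) : Prop :=
  ∃ M : ℝ, ∀ t : ℝ, 0 ≤ t → ‖T t‖ ≤ M

/-- The (possibly unbounded) operator `A` is the infinitesimal generator of `T`:
`x ∈ D(A)` and `A x = y` if and only if `(T h x - x) / h → y` as `h ↓ 0`. -/
def IsGenerator [NormedSpace ℝ X] (A : X →ₗ.[𝕜] X) (T : ℝ → X →L[𝕜] X) : Prop :=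
  ∀ x y : X, (x, y) ∈ A.graph ↔
    Tendsto (fun h : ℝ => h⁻¹ • (T h x - x)) (𝓝[>] 0) (𝓝 y)

/-- `R` is the bounded everywhere defined operator `(A - z)⁻¹`: it maps `X` into `D(A)`, and it is
a right and a left inverse of `A - z : D(A) → X`. -/
structure IsInverseOfSub (A : X →ₗ.[𝕜] X) (z : 𝕜) (R : X →L[𝕜] X) : Prop where
  mem_domain : ∀ x : X, R x ∈ A.domain
  right_inv : ∀ x : X, A ⟨R x, mem_domain x⟩ - z • R x = x
  left_inv : ∀ x : A.domain, R (A x - z • (x : X)) = x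

/-- `B` is the bounded operator `∫₀^∞ f(s) T(s) ds`, the integral being taken in the strong sense:
for each `x` the integral of `f(s) T(s) x` converges absolutely and has the value `B x`. -/
def IsStrongIntegral [NormedSpace ℝ X] (f : ℝ → ℝ) (T : ℝ → X →L[𝕜] X) (B : X →L[𝕜] X) : Prop :=
  ∀ x : X, IntegrableOn (fun s => f s • T s x) (Ioi 0) ∧ B x = ∫ s in Ioi (0 : ℝ), f s • T s x

/-- `‖B n t‖` is bounded uniformly in `n` and in `t` from compact subsets of `[0, ∞)`. -/
def UniformlyBoundedOnCompacts (B : ℕ → ℝ → X →L[𝕜] X) : Prop :=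
  ∀ K : Set ℝ, K ⊆ Ici 0 → IsCompact K → ∃ C : ℝ, ∀ n : ℕ, ∀ t ∈ K, ‖B n t‖ ≤ C

/-- For every `x` the sequence of functions `t ↦ E n t x` converges uniformly on compact subsets
of `[0, ∞)`. -/
def StronglyConvergesOnCompacts (E : ℕ → ℝ → X →L[𝕜] X) : Prop :=
  ∀ x : X, ∃ u : ℝ → X, ∀ K : Set ℝ, K ⊆ Ici 0 → IsCompact K →
    TendstoUniformlyOn (fun n t => E n t x) u atTop K

end Semigroups

/-! Write `V = ∫ e^{-εs} T(s) ds`, so that `-V = (A - ε)⁻¹ = R`. Repeated integration by parts gives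
`∫ s^k/k! e^{-εs} T(s) ds = V^{k+1}`. Expanding `b_t(s)` in powers of `t` and integrating term by
term yields the exponential series without its zeroth term: `B_n(t) = e^{tR_n} - 1`
(`IsStrongIntegral.exp_sub_one`). Thus (i) says that the `e^{tR_n}` are bounded uniformly in `n`,
locally in `t`.

(ii) implies this by Banach–Steinhaus. Conversely, the `R_n` commute, so `‖e^{tR_m}x - e^{tR_n}x‖ ≤
C² t ‖R_m x - R_n x‖` (`norm_exp_smul_sub_le`). On the dense range of `A` one has `R_n x → A⁻¹x`,
and the uniform bound carries convergence to all of `X`.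

The generator of the limit extends `A⁻¹` by a difference quotient estimate uniform in `n`. It is no
larger, because for large `c` the operator `c - A⁻¹` is onto while `c` is not an eigenvalue of the
generator (`isGenerator_inverse_of_tendsto_exp`). -/

/-! ### Power series and integrability of the damped Bessel kernel. -/

/-- The `k`-th term of the power series in `t` of `besselKernel t s * exp (-(ε s))`. -/
noncomputable def besselKernelTerm (ε t : ℝ) (k : ℕ) (s : ℝ) : ℝ :=
  (-1) ^ (k + 1) * t ^ (k + 1) / (k + 1).factorial * (s ^ k / k.factorial * Real.exp (-(ε * s)))

/-- A summable majorant of `besselKernelTerm`. -/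
noncomputable def besselKernelMajorant (ε t : ℝ) (k : ℕ) (s : ℝ) : ℝ :=
  t * Real.exp (2 * t / ε) * Real.exp (-(ε * s)) * ((ε * s / 2) ^ k / k.factorial)

theorem besselJ_one_term {t s : ℝ} (ht : 0 ≤ t) (hs : 0 < s) (m : ℕ) :
    -(√t * ((-1) ^ m / ((m.factorial : ℝ) * ((m + 1).factorial : ℝ)) *
      (2 * √(t * s) / 2) ^ (2 * m + 1) / √s)) =
    (-1) ^ (m + 1) * t ^ (m + 1) / (m + 1).factorial * (s ^ m / m.factorial) := by
  have h1 : √s ≠ 0 := (Real.sqrt_pos.2 hs).ne'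
  have h2 : (2 * √(t * s) / 2) ^ (2 * m + 1) = t ^ m * s ^ m * (√t * √s) := by
    rw [mul_div_cancel_left₀ _ two_ne_zero, pow_succ, pow_mul,
      Real.sq_sqrt (mul_nonneg ht hs.le), mul_pow, Real.sqrt_mul ht]
  have h3 : √t * √t = t := Real.mul_self_sqrt ht
  have h4 : (m.factorial : ℝ) ≠ 0 := by positivity
  have h5 : ((m + 1).factorial : ℝ) ≠ 0 := by positivity
  rw [h2]
  field_simp
  rw [pow_two, h3]
  ring

/-- Split `(ts)^k = (2t/ε)^k (εs/2)^k`. One factorial absorbs the first factor into `e^{2t/ε}`; the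
other makes the second sum to `e^{εs/2}`, which leaves the decay `e^{-εs/2}`. -/
theorem abs_besselKernelTerm_le {ε t s : ℝ} (hε : 0 < ε) (ht : 0 ≤ t) (hs : 0 ≤ s) (k : ℕ) :
    |besselKernelTerm ε t k s| ≤ besselKernelMajorant ε t k s := by
  unfold besselKernelTerm besselKernelMajorant
  have h1 : (2 * t / ε) ^ k / k.factorial ≤ Real.exp (2 * t / ε) :=
    Real.pow_div_factorial_le_exp _ (by positivity) _
  have h2 : t ^ (k + 1) / (k + 1).factorial * (s ^ k / k.factorial * Real.exp (-(ε * s))) ≤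
      t ^ (k + 1) / k.factorial * (s ^ k / k.factorial * Real.exp (-(ε * s))) := by
    gcongr
    exact Nat.le_succ k
  rw [abs_mul, abs_div, abs_mul, abs_pow, abs_neg, abs_one, one_pow, one_mul,
    abs_of_nonneg (by positivity : 0 ≤ t ^ (k + 1)),
    abs_of_nonneg (by positivity : (0 : ℝ) ≤ (k + 1).factorial),
    abs_of_nonneg (by positivity : 0 ≤ s ^ k / k.factorial * Real.exp (-(ε * s)))]
  refine h2.trans ?_
  calc t ^ (k + 1) / k.factorial * (s ^ k / k.factorial * Real.exp (-(ε * s)))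
      = t * ((2 * t / ε) ^ k / k.factorial) * Real.exp (-(ε * s)) *
          ((ε * s / 2) ^ k / k.factorial) := by
        have : (2 * t / ε) ^ k * (ε * s / 2) ^ k = t ^ k * s ^ k := by
          rw [← mul_pow, ← mul_pow]; congr 1; field_simp
        rw [pow_succ]
        linear_combination (-t * Real.exp (-(ε * s)) / (k.factorial : ℝ) ^ 2) * this
    _ ≤ _ := by gcongr

theorem hasSum_besselKernelMajorant (ε t s : ℝ) :
    HasSum (fun k => besselKernelMajorant ε t k s)
      (t * Real.exp (2 * t / ε) * Real.exp (-(ε / 2 * s))) := by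
  have h := (NormedSpace.expSeries_div_hasSum_exp (𝔸 := ℝ) (ε * s / 2)).mul_left
    (t * Real.exp (2 * t / ε) * Real.exp (-(ε * s)))
  rw [← Real.exp_eq_exp_ℝ, mul_assoc (t * Real.exp (2 * t / ε)), ← Real.exp_add] at h
  have he : -(ε * s) + ε * s / 2 = -(ε / 2 * s) := by ring
  rwa [he] at h

theorem hasSum_besselKernelTerm {ε t s : ℝ} (hε : 0 < ε) (ht : 0 ≤ t) (hs : 0 < s) :
    HasSum (fun k => besselKernelTerm ε t k s) (besselKernel t s * Real.exp (-(ε * s))) := by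
  have hsum : Summable (fun k => besselKernelTerm ε t k s) :=
    .of_norm_bounded (hasSum_besselKernelMajorant ε t s).summable
      fun k => abs_besselKernelTerm_le hε ht hs.le k
  convert hsum.hasSum using 1
  rw [besselKernel, besselJ, ← tsum_div_const, ← tsum_mul_left, ← tsum_neg, ← tsum_mul_right]
  refine tsum_congr fun m => ?_
  rw [besselJ_one_term ht hs, besselKernelTerm, mul_assoc]

theorem pow_div_factorial_mul_exp_le {ε s : ℝ} (hε : 0 < ε) (hs : 0 ≤ s) (k : ℕ) :
    s ^ k / k.factorial * Real.exp (-(ε * s)) ≤ (2 / ε) ^ k * Real.exp (-(ε / 2 * s)) := by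
  have h1 := Real.pow_div_factorial_le_exp (ε * s / 2) (by positivity) k
  calc s ^ k / k.factorial * Real.exp (-(ε * s))
      = (2 / ε) ^ k * ((ε * s / 2) ^ k / k.factorial) * Real.exp (-(ε * s)) := by
        rw [mul_div_assoc', ← mul_pow]
        congr 3
        field_simp
    _ ≤ (2 / ε) ^ k * Real.exp (ε * s / 2) * Real.exp (-(ε * s)) := by gcongr
    _ = _ := by
        rw [mul_assoc, ← Real.exp_add]
        congr 2
        ring

theorem integrableOn_exp_neg_mul {c : ℝ} (hc : 0 < c) :
    IntegrableOn (fun s => Real.exp (-(c * s))) (Ioi 0) := by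
  simpa using exp_neg_integrableOn_Ioi 0 hc

theorem integrableOn_pow_div_factorial_mul_exp {ε : ℝ} (hε : 0 < ε) (k : ℕ) :
    IntegrableOn (fun s => s ^ k / k.factorial * Real.exp (-(ε * s))) (Ioi 0) := by
  refine Integrable.mono' ((integrableOn_exp_neg_mul (half_pos hε)).const_mul ((2 / ε) ^ k))
    (by fun_prop) ((ae_restrict_mem measurableSet_Ioi).mono fun s (hs : 0 < s) => ?_)
  rw [Real.norm_of_nonneg (by positivity)]
  exact pow_div_factorial_mul_exp_le hε hs.le k

theorem tendsto_pow_div_factorial_mul_exp {ε : ℝ} (hε : 0 < ε) (k : ℕ) :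
    Tendsto (fun s => s ^ k / k.factorial * Real.exp (-(ε * s))) atTop (𝓝 0) := by
  have h : Tendsto (fun s => (2 / ε) ^ k * Real.exp (-(ε / 2 * s))) atTop (𝓝 ((2 / ε) ^ k * 0)) :=
    (Real.tendsto_exp_neg_atTop_nhds_zero.comp
      (tendsto_id.const_mul_atTop (half_pos hε))).const_mul _
  rw [mul_zero] at h
  refine squeeze_zero' ?_ ?_ h <;> filter_upwards [eventually_ge_atTop 0] with s hs
  · positivity
  · exact pow_div_factorial_mul_exp_le hε hs k

theorem integrableOn_besselKernel_mul_exp {ε t : ℝ} (hε : 0 < ε) (ht : 0 ≤ t) :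
    IntegrableOn (fun s => besselKernel t s * Real.exp (-(ε * s))) (Ioi 0) := by
  have hm : ∀ k, AEStronglyMeasurable (besselKernelTerm ε t k) (volume.restrict (Ioi 0)) := by
    intro k
    unfold besselKernelTerm
    fun_prop
  have hsum : ∀ᵐ s ∂volume.restrict (Ioi (0 : ℝ)), HasSum (fun k => besselKernelTerm ε t k s)
      (besselKernel t s * Real.exp (-(ε * s))) :=
    (ae_restrict_mem measurableSet_Ioi).mono fun s hs => hasSum_besselKernelTerm hε ht hs
  refine Integrable.mono' ((integrableOn_exp_neg_mul (half_pos hε)).const_mul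
    (t * Real.exp (2 * t / ε))) ?_ ?_
  · refine aestronglyMeasurable_of_tendsto_ae atTop
      (f := fun (n : ℕ) s => ∑ k ∈ Finset.range n, besselKernelTerm ε t k s) (fun n => ?_)
      (hsum.mono fun s hs => hs.tendsto_sum_nat)
    exact Finset.aestronglyMeasurable_fun_sum _ fun k _ => hm k
  · filter_upwards [ae_restrict_mem measurableSet_Ioi] with s (hs : 0 < s)
    rw [← (hasSum_besselKernelTerm hε ht hs).tsum_eq]
    exact tsum_of_norm_bounded (hasSum_besselKernelMajorant ε t s)
      fun k => abs_besselKernelTerm_le hε ht hs.le k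

/-! ### Exponentials of bounded operators. -/

section Exponential

variable {𝕜 X : Type*} [RCLike 𝕜] [NormedAddCommGroup X] [NormedSpace 𝕜 X]

theorem exp_add_of_commute_clm [CompleteSpace X] {P Q : X →L[𝕜] X} (h : Commute P Q) :
    NormedSpace.exp (P + Q) = NormedSpace.exp P * NormedSpace.exp Q :=
  NormedSpace.exp_add_of_commute_of_mem_ball (𝕂 := 𝕜) h
    (by simp [NormedSpace.expSeries_radius_eq_top]) (by simp [NormedSpace.expSeries_radius_eq_top])

theorem exp_smul_add (P : X →L[𝕜] X) [CompleteSpace X] (s t : ℝ) :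
    NormedSpace.exp (((s + t : ℝ) : 𝕜) • P) =
      NormedSpace.exp ((s : 𝕜) • P) * NormedSpace.exp ((t : 𝕜) • P) := by
  rw [RCLike.ofReal_add, add_smul]
  exact exp_add_of_commute_clm
    (((Commute.refl P).smul_left _).smul_right _)

theorem hasSum_exp_smul_apply [CompleteSpace X] (P : X →L[𝕜] X) (t : 𝕜) (x : X) :
    HasSum (fun k : ℕ => ((k.factorial : 𝕜)⁻¹ * t ^ k) • (P ^ k) x)
      (NormedSpace.exp (t • P) x) := by
  have h := NormedSpace.exp_series_hasSum_exp' (𝕂 := 𝕜) (t • P)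
  have h2 := (ContinuousLinearMap.apply 𝕜 X x).hasSum h
  simpa [smul_pow, smul_smul] using h2

theorem hasDerivAt_exp_smul_apply [CompleteSpace X] [NormedSpace ℝ X] [IsScalarTower ℝ 𝕜 X]
    (P : X →L[𝕜] X) (x : X) (t : ℝ) :
    HasDerivAt (fun s : ℝ => NormedSpace.exp ((s : 𝕜) • P) x)
      (NormedSpace.exp ((t : 𝕜) • P) (P x)) t := by
  have h : HasDerivAt (fun z : 𝕜 => NormedSpace.exp (z • P) x)
      (NormedSpace.exp ((t : 𝕜) • P) (P x)) (t : 𝕜) := by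
    simpa using (hasDerivAt_exp_smul_const P (t : 𝕜)).clm_apply (hasDerivAt_const (t : 𝕜) x)
  have h2 := h.scomp t (RCLike.ofRealCLM (K := 𝕜)).hasDerivAt
  simpa [Function.comp_def] using h2

theorem continuous_exp_smul_apply [CompleteSpace X] [NormedSpace ℝ X] [IsScalarTower ℝ 𝕜 X]
    (P : X →L[𝕜] X) (x : X) : Continuous (fun s : ℝ => NormedSpace.exp ((s : 𝕜) • P) x) :=
  continuous_iff_continuousAt.2 fun t => (hasDerivAt_exp_smul_apply P x t).continuousAt

/-- By commutativity `s ↦ e^{tQ} e^{s(P-Q)} x = e^{(t-s)Q} e^{sP} x` joins `e^{tQ}x` to `e^{tP}x`,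
and its derivative is bounded by `C² ‖Px - Qx‖`. -/
theorem norm_exp_smul_sub_le [CompleteSpace X] [NormedSpace ℝ X] [IsScalarTower ℝ 𝕜 X]
    {P Q : X →L[𝕜] X} (hPQ : Commute P Q) {C t : ℝ} (ht : 0 ≤ t)
    (hP : ∀ s ∈ Icc 0 t, ‖NormedSpace.exp ((s : 𝕜) • P)‖ ≤ C)
    (hQ : ∀ s ∈ Icc 0 t, ‖NormedSpace.exp ((s : 𝕜) • Q)‖ ≤ C) (x : X) :
    ‖NormedSpace.exp ((t : 𝕜) • P) x - NormedSpace.exp ((t : 𝕜) • Q) x‖ ≤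
      C * C * ‖P x - Q x‖ * t := by
  have key : ∀ s : ℝ, NormedSpace.exp ((t : 𝕜) • Q) * NormedSpace.exp ((s : 𝕜) • (P - Q)) =
      NormedSpace.exp (((t - s : ℝ) : 𝕜) • Q) * NormedSpace.exp ((s : 𝕜) • P) := by
    intro s
    rw [← exp_add_of_commute_clm, ← exp_add_of_commute_clm]
    · congr 1
      push_cast
      module
    · exact (hPQ.symm.smul_left _).smul_right _
    · exact ((hPQ.symm.sub_right (Commute.refl Q)).smul_left _).smul_right _
  have hC : 0 ≤ C := (norm_nonneg _).trans (hP 0 ⟨le_rfl, ht⟩)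
  have h := norm_image_sub_le_of_norm_deriv_le_segment' (a := 0) (b := t)
    (f := fun s : ℝ => NormedSpace.exp ((t : 𝕜) • Q) (NormedSpace.exp ((s : 𝕜) • (P - Q)) x))
    (f' := fun s : ℝ => NormedSpace.exp ((t : 𝕜) • Q)
      (NormedSpace.exp ((s : 𝕜) • (P - Q)) ((P - Q) x)))
    (C := C * C * ‖P x - Q x‖) (fun s _ => ?_) (fun s hs => ?_) t ⟨ht, le_rfl⟩
  · have h0 := congrArg (fun L : X →L[𝕜] X => L x) (key t)
    simp only [mul_apply_eq_comp, sub_self, RCLike.ofReal_zero, zero_smul,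
      NormedSpace.exp_zero, one_apply_eq_self] at h0
    simpa only [h0, RCLike.ofReal_zero, zero_smul, NormedSpace.exp_zero, one_apply_eq_self,
      sub_zero] using h
  · have h2 := ((NormedSpace.exp ((t : 𝕜) • Q)).restrictScalars ℝ).hasFDerivAt.comp_hasDerivAt s
      (hasDerivAt_exp_smul_apply (P - Q) x s)
    exact h2.hasDerivWithinAt
  · have h0 := congrArg (fun L : X →L[𝕜] X => L ((P - Q) x)) (key s)
    simp only [mul_apply_eq_comp] at h0
    rw [h0, mul_assoc]
    refine (ContinuousLinearMap.le_of_opNorm_le _ (hQ _ ⟨by linarith [hs.2], by linarith [hs.1]⟩)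
      _).trans (mul_le_mul_of_nonneg_left ?_ hC)
    exact ContinuousLinearMap.le_of_opNorm_le _ (hP _ ⟨hs.1, hs.2.le⟩) _

theorem norm_exp_smul_sub_sub_le [CompleteSpace X] [NormedSpace ℝ X] [IsScalarTower ℝ 𝕜 X]
    (P : X →L[𝕜] X) {δ h : ℝ} (hh : 0 ≤ h) (x y : X)
    (hδ : ∀ s ∈ Icc 0 h, ‖NormedSpace.exp ((s : 𝕜) • P) (P x) - y‖ ≤ δ) :
    ‖NormedSpace.exp ((h : 𝕜) • P) x - x - h • y‖ ≤ δ * h := by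
  have := norm_image_sub_le_of_norm_deriv_le_segment' (a := 0) (b := h)
    (f := fun s : ℝ => NormedSpace.exp ((s : 𝕜) • P) x - s • y)
    (f' := fun s : ℝ => NormedSpace.exp ((s : 𝕜) • P) (P x) - y) (C := δ)
    (fun s _ => ?_) (fun s hs => hδ s ⟨hs.1, hs.2.le⟩) h ⟨hh, le_rfl⟩
  · simpa [sub_right_comm] using this
  · have := (hasDerivAt_exp_smul_apply P x s).sub ((hasDerivAt_id s).smul_const y)
    rw [one_smul] at this
    exact this.hasDerivWithinAt

end Exponential

/-! ### Resolvents and their behaviour as `ε → 0`. -/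

section Inverse

variable {𝕜 X : Type*} [RCLike 𝕜] [NormedAddCommGroup X] [NormedSpace 𝕜 X]

/-- Apply `P` to `(A - z)Qx = x + (w - z)Qx`. -/
theorem IsInverseOfSub.resolvent_identity {A : X →ₗ.[𝕜] X} {z w : 𝕜} {P Q : X →L[𝕜] X}
    (hP : IsInverseOfSub A z P) (hQ : IsInverseOfSub A w Q) (x : X) :
    Q x = P x + (w - z) • P (Q x) := by
  have h1 : P (A ⟨Q x, hQ.mem_domain x⟩ - z • Q x) = Q x :=
    hP.left_inv ⟨Q x, hQ.mem_domain x⟩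
  have h2 := hQ.right_inv x
  rw [sub_eq_iff_eq_add] at h2
  rw [h2] at h1
  conv_lhs => rw [← h1]
  simp only [map_sub, map_add, map_smul]
  module

theorem IsInverseOfSub.commute {A : X →ₗ.[𝕜] X} {z w : 𝕜} {P Q : X →L[𝕜] X}
    (hP : IsInverseOfSub A z P) (hQ : IsInverseOfSub A w Q) : Commute P Q := by
  ext x
  have h1 := hP.resolvent_identity hQ x
  have h2 := hQ.resolvent_identity hP x
  rcases eq_or_ne w z with rfl | hne
  · simp only [sub_self, zero_smul, add_zero] at h1
    have h3 : ∀ x, Q x = P x := fun x => by simpa using hP.resolvent_identity hQ x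
    simp [h3]
  · have h3 : (w - z) • (P (Q x) - Q (P x)) = 0 := by
      have : (w - z) • P (Q x) = Q x - P x := by 
        conv_rhs => rw [h1]
        rw [add_sub_cancel_left]
      have h4 : (z - w) • Q (P x) = P x - Q x := by
        conv_rhs => rw [h2]
        rw [add_sub_cancel_left]
      rw [smul_sub, this, ← neg_sub z w, neg_smul, h4]
      abel
    have := (smul_eq_zero.1 h3).resolve_left (sub_ne_zero.2 hne)
    simpa [sub_eq_zero] using this

/-- On the range of `A` the operators `(A - εₙ)⁻¹` converge to `A⁻¹`. -/
theorem tendsto_inverseOfSub_of_mem_range {A : X →ₗ.[𝕜] X} (hdense : DenseRange A)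
    {ε : ℕ → ℝ} (hε0 : Tendsto ε atTop (𝓝 0)) {R : ℕ → X →L[𝕜] X}
    (hR : ∀ n, IsInverseOfSub A (ε n : 𝕜) (R n)) {M : ℝ} (hM : ∀ n x, ‖(ε n : 𝕜) • R n x‖ ≤ M * ‖x‖)
    (y : A.domain) : Tendsto (fun n => R n (A y)) atTop (𝓝 (y : X)) := by
  have hRA : ∀ n (z : A.domain), R n (A z) = z + (ε n : 𝕜) • R n z := by
    intro n z
    have h := (hR n).left_inv z
    rw [map_sub, map_smul, sub_eq_iff_eq_add] at h
    exact h
  have hε1 : Tendsto (fun n => (ε n : 𝕜)) atTop (𝓝 0) := by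
    simpa [Function.comp_def] using (RCLike.continuous_ofReal (K := 𝕜)).continuousAt.tendsto.comp hε0
  have hrange : ∀ z : A.domain, Tendsto (fun n => (ε n : 𝕜) • R n (A z)) atTop (𝓝 0) := by
    intro z
    have hb : IsBoundedUnder (· ≤ ·) atTop ((‖·‖) ∘ fun n => R n (A z)) := by
      refine isBoundedUnder_of ⟨‖(z : X)‖ + M * ‖(z : X)‖, fun n => ?_⟩
      simp only [Function.comp_apply, hRA]
      exact (norm_add_le _ _).trans (by gcongr; exact hM _ _)
    exact hε1.zero_smul_isBoundedUnder_le hb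
  -- The bound `‖ε_n R_n‖ ≤ M` extends the convergence from the dense range; in view of `hRA`, the
  -- case `x = y` is the claim.
  have hall : ∀ x : X, Tendsto (fun n => (ε n : 𝕜) • R n x) atTop (𝓝 0) := by
    intro x
    rw [Metric.tendsto_atTop]
    intro δ hδ
    have hM' : 0 < |M| + 1 := by positivity
    obtain ⟨z, hz⟩ := hdense.exists_dist_lt x (div_pos (half_pos hδ) hM')
    obtain ⟨N, hN⟩ := Metric.tendsto_atTop.1 (hrange z) (δ / 2) (half_pos hδ)
    refine ⟨N, fun n hn => ?_⟩
    have h1 := hN n hn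
    rw [dist_zero_right] at h1 ⊢
    have h2 : (ε n : 𝕜) • R n x = (ε n : 𝕜) • R n (x - A z) + (ε n : 𝕜) • R n (A z) := by
      rw [map_sub, smul_sub, sub_add_cancel]
    rw [dist_eq_norm, lt_div_iff₀ hM'] at hz
    have h3 : ‖(ε n : 𝕜) • R n (x - A z)‖ ≤ ‖x - A z‖ * (|M| + 1) := by
      refine (hM _ _).trans ?_
      rw [mul_comm]
      gcongr
      linarith [le_abs_self M]
    rw [h2]
    linarith [norm_add_le ((ε n : 𝕜) • R n (x - A z)) ((ε n : 𝕜) • R n (A z))]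
  simpa [hRA] using (hall y).const_add (y : X)

end Inverse

/-! ### Laplace transforms of the semigroup and the identity `B = e^{tR} - 1`. -/

section StrongIntegral

variable {𝕜 X : Type*} [RCLike 𝕜] [NormedAddCommGroup X] [NormedSpace 𝕜 X] [NormedSpace ℝ X]
  {T : ℝ → X →L[𝕜] X} {M : ℝ}

theorem IsC0Semigroup.integrableOn_smul (hT : IsC0Semigroup T) (hM : ∀ t, 0 ≤ t → ‖T t‖ ≤ M)
    {g : ℝ → ℝ} (hg : IntegrableOn g (Ioi 0)) (x : X) :
    IntegrableOn (fun s => g s • T s x) (Ioi 0) := by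
  refine Integrable.mono' (hg.norm.mul_const (M * ‖x‖)) (hg.aestronglyMeasurable.smul
    (((hT.strongly_continuous x).mono Ioi_subset_Ici_self).aestronglyMeasurable measurableSet_Ioi))
    ((ae_restrict_mem measurableSet_Ioi).mono fun s (hs : 0 < s) => ?_)
  rw [norm_smul]
  gcongr
  exact (T s).le_of_opNorm_le (hM s hs.le) x

variable [IsScalarTower ℝ 𝕜 X]

theorem IsC0Semigroup.exists_isStrongIntegral (hT : IsC0Semigroup T)
    (hM : ∀ t, 0 ≤ t → ‖T t‖ ≤ M) {g : ℝ → ℝ} (hg : IntegrableOn g (Ioi 0)) :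
    ∃ B : X →L[𝕜] X, IsStrongIntegral g T B ∧ ‖B‖ ≤ (∫ s in Ioi (0 : ℝ), ‖g s‖) * M := by
  have hM0 : 0 ≤ M := (norm_nonneg _).trans (hM 0 le_rfl)
  have hint := fun x => hT.integrableOn_smul hM hg x
  let L : X →ₗ[𝕜] X :=
    { toFun := fun x => ∫ s in Ioi (0 : ℝ), g s • T s x
      map_add' := fun x y => by
        refine Eq.trans (integral_congr_ae (ae_of_all _ fun s => ?_))
          (integral_add (hint x) (hint y))
        beta_reduce
        rw [_root_.map_add, smul_add]
      map_smul' := fun c x => by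
        refine Eq.trans (integral_congr_ae (ae_of_all _ fun s => ?_)) (integral_smul c _)
        simp only [map_smul]
        exact smul_comm _ _ _ }
  have hL : ∀ x, ‖L x‖ ≤ (∫ s in Ioi (0 : ℝ), ‖g s‖) * M * ‖x‖ := by
    intro x
    rw [mul_assoc, ← integral_mul_const]
    refine norm_integral_le_of_norm_le (hg.norm.mul_const _)
      ((ae_restrict_mem measurableSet_Ioi).mono fun s (hs : 0 < s) => ?_)
    rw [norm_smul]
    gcongr
    exact (T s).le_of_opNorm_le (hM s hs.le) x
  exact ⟨L.mkContinuous _ hL, fun x => ⟨hint x, rfl⟩,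
    LinearMap.mkContinuous_norm_le _
      (mul_nonneg (integral_nonneg fun _ => norm_nonneg _) hM0) hL⟩

variable [CompleteSpace X] {ε : ℝ} {V : X →L[𝕜] X}

theorem IsStrongIntegral.commute {g : ℝ → ℝ} (hT : IsC0Semigroup T) (hV : IsStrongIntegral g T V)
    {h : ℝ} (hh : 0 ≤ h) (x : X) : T h (V x) = V (T h x) := by
  rw [(hV x).2, (hV _).2, ← ContinuousLinearMap.integral_comp_comm _ (hV x).1]
  refine setIntegral_congr_fun measurableSet_Ioi fun s (hs : 0 < s) => ?_
  simp only [ContinuousLinearMap.map_smul_of_tower, ← mul_apply_eq_comp]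
  rw [← hT.map_add h s hh hs.le, ← hT.map_add s h hs.le hh, add_comm]

/-- The orbits of the Laplace transform `V` of `T`, rescaled, are antiderivatives of the rescaled
orbits of `T`. -/
theorem IsStrongIntegral.exists_hasDerivAt (hT : IsC0Semigroup T)
    (hV : IsStrongIntegral (fun s => Real.exp (-(ε * s))) T V) (x : X) :
    ∃ G f : ℝ → X, Continuous f ∧ (∀ s, 0 ≤ s → f s = Real.exp (-(ε * s)) • T s x) ∧
      (∀ s, 0 ≤ s → G s = Real.exp (-(ε * s)) • T s (V x)) ∧ ∀ s, HasDerivAt G (-f s) s := by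
  -- `T` is arbitrary at negative times; freezing it at `0` makes `f` continuous on `ℝ`, so that `G`
  -- has two-sided derivatives.
  set f : ℝ → X := fun s => Real.exp (-(ε * s)) • T (max s 0) x with hf
  have hfc : Continuous f := by
    refine Continuous.smul (by fun_prop) ?_
    exact (hT.strongly_continuous x).comp_continuous (by fun_prop) fun s => mem_Ici.2 (le_max_right _ _)
  have hfs : ∀ s, 0 ≤ s → f s = Real.exp (-(ε * s)) • T s x := by
    intro s hs
    simp only [hf, max_eq_left hs]
  have hfi : IntegrableOn f (Ioi 0) :=
    (hV x).1.congr_fun (fun s (hs : 0 < s) => (hfs s hs.le).symm) measurableSet_Ioi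
  have hVf : V x = ∫ s in Ioi (0 : ℝ), f s := by
    rw [(hV x).2]
    exact setIntegral_congr_fun measurableSet_Ioi fun s (hs : 0 < s) => (hfs s hs.le).symm
  refine ⟨fun s => V x - ∫ r in (0 : ℝ)..s, f r, f, hfc, hfs, fun h hh => ?_, fun s => ?_⟩
  -- By the semigroup law `T h` shifts the integral, so both sides are the tail of `∫ f`.
  · have h1 : Real.exp (-(ε * h)) • T h (V x) = ∫ s in Ioi h, f s := by
      have hpre : (fun s : ℝ => s + h) ⁻¹' Ioi h = Ioi 0 := by ext s; simp
      rw [← (measurePreserving_add_right volume h).setIntegral_preimage_emb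
        (measurableEmbedding_addRight h) f (Ioi h), hpre, (hV x).2,
        ← ContinuousLinearMap.integral_comp_comm _ (hV x).1, ← integral_smul]
      refine setIntegral_congr_fun measurableSet_Ioi fun s (hs : 0 < s) => ?_
      simp only [ContinuousLinearMap.map_smul_of_tower, ← mul_apply_eq_comp]
      rw [← hT.map_add h s hh hs.le, hfs _ (add_nonneg hs.le hh), smul_smul, ← Real.exp_add,
        add_comm h s]
      ring_nf
    beta_reduce
    rw [h1, hVf, ← intervalIntegral.integral_Ioi_sub_Ioi hfi hh, sub_sub_cancel]
  · simpa using (intervalIntegral.integral_hasDerivAt_right (hfc.intervalIntegrable _ _)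
      (hfc.stronglyMeasurableAtFilter _ _) hfc.continuousAt).const_sub (V x)

/-- Product rule at `0` for `T(s)Vx = e^{εs} G(s)`. -/
theorem IsStrongIntegral.tendsto_slope (hT : IsC0Semigroup T)
    (hV : IsStrongIntegral (fun s => Real.exp (-(ε * s))) T V) (x : X) :
    Tendsto (fun h : ℝ => h⁻¹ • (T h (V x) - V x)) (𝓝[>] 0) (𝓝 (ε • V x - x)) := by
  obtain ⟨G, f, -, hf, hG, hd⟩ := hV.exists_hasDerivAt hT x
  have he : HasDerivAt (fun s : ℝ => Real.exp (ε * s)) ε 0 := by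
    simpa using ((hasDerivAt_id (0 : ℝ)).const_mul ε).exp
  have h1 := (he.smul (hd 0)).hasDerivWithinAt (s := Ioi 0)
  rw [hasDerivWithinAt_iff_tendsto_slope' (by simp)] at h1
  have h0 := hT.map_zero
  have h2 : Real.exp (ε * 0) • -f 0 + ε • G 0 = ε • V x - x := by
    rw [hf 0 le_rfl, hG 0 le_rfl, h0]
    simp [sub_eq_add_neg, add_comm]
  rw [h2] at h1
  refine h1.congr' ?_
  filter_upwards [self_mem_nhdsWithin] with h (hh : 0 < h)
  simp [slope_def_module, hG h hh.le, hG 0 le_rfl, h0, smul_smul, ← Real.exp_add]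

/-- The Laplace transform of a bounded semigroup is the resolvent of its generator. -/
theorem IsStrongIntegral.isInverseOfSub (hT : IsC0Semigroup T) {A : X →ₗ.[𝕜] X}
    (hA : IsGenerator A T) (hV : IsStrongIntegral (fun s => Real.exp (-(ε * s))) T V) :
    IsInverseOfSub A (ε : 𝕜) (-V) := by
  have hmem : ∀ x, (V x, ε • V x - x) ∈ A.graph := fun x => (hA _ _).2 (hV.tendsto_slope hT x)
  have hneg : ∀ x, ∃ h : (-V) x ∈ A.domain, A ⟨(-V) x, h⟩ = -(ε • V x - x) := by
    intro x
    have := A.graph.neg_mem (hmem x)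
    obtain ⟨y, hy1, hy2⟩ := LinearPMap.mem_graph_iff _ |>.1 this
    have hy1' : (y : X) = (-V) x := hy1
    refine ⟨hy1' ▸ y.2, ?_⟩
    rw [← show A y = -(ε • V x - x) from hy2]
    congr 1
    exact Subtype.ext hy1'.symm
  refine ⟨fun x => (hneg x).1, fun x => ?_, fun x => ?_⟩
  · rw [(hneg x).2, RCLike.real_smul_eq_coe_smul (K := 𝕜)]
    simp
  -- `V` commutes with `T`, so the difference quotients at `Vx` tend both to `V(Ax)` and to `εVx -
  -- x`.
  · have h1 := (hA x (A x)).1 (A.mem_graph x)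
    have h2 := (V.continuous.tendsto (A x)).comp h1
    have h3 : Tendsto (fun h : ℝ => h⁻¹ • (T h (V x) - V x)) (𝓝[>] 0) (𝓝 (V (A x))) := by
      refine h2.congr' ?_
      filter_upwards [self_mem_nhdsWithin] with h (hh : 0 < h)
      simp only [Function.comp_apply, ContinuousLinearMap.map_smul_of_tower, map_sub,
        hV.commute hT hh.le]
    have h4 := tendsto_nhds_unique h3 (hV.tendsto_slope hT x)
    rw [map_sub, map_smul, neg_apply, neg_apply, h4, RCLike.real_smul_eq_coe_smul (K := 𝕜)]
    simp

/-- Integration by parts against `G`: the boundary term vanishes at `0` because of `s^{k+1}` and at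
infinity by exponential decay. -/
theorem IsStrongIntegral.integral_pow_succ (hT : IsC0Semigroup T)
    (hM : ∀ t, 0 ≤ t → ‖T t‖ ≤ M) (hε : 0 < ε)
    (hV : IsStrongIntegral (fun s => Real.exp (-(ε * s))) T V) (k : ℕ) (x : X) :
    ∫ s in Ioi (0 : ℝ), (s ^ (k + 1) / (k + 1).factorial * Real.exp (-(ε * s))) • T s x =
      ∫ s in Ioi (0 : ℝ), (s ^ k / k.factorial * Real.exp (-(ε * s))) • T s (V x) := by
  obtain ⟨G, f, -, hf, hG, hd⟩ := hV.exists_hasDerivAt hT x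
  have hi1 := hT.integrableOn_smul hM (integrableOn_pow_div_factorial_mul_exp hε k) (V x)
  have hi2 := hT.integrableOn_smul hM (integrableOn_pow_div_factorial_mul_exp hε (k + 1)) x
  have hp : ∀ s : ℝ, HasDerivAt (fun s : ℝ => s ^ (k + 1) / ((k + 1).factorial : ℝ))
      (s ^ k / k.factorial) s := by
    intro s
    have h := (hasDerivAt_pow (k + 1) s).div_const ((k + 1).factorial : ℝ)
    rwa [Nat.add_sub_cancel, Nat.factorial_succ, Nat.cast_mul,
      mul_div_mul_left _ _ (by positivity), ← Nat.cast_mul, ← Nat.factorial_succ] at h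
  have hlim : Tendsto (fun s => (s ^ (k + 1) / ((k + 1).factorial : ℝ)) • G s) atTop (𝓝 0) := by
    have h0 := (tendsto_pow_div_factorial_mul_exp hε (k + 1)).mul_const (M * ‖V x‖)
    rw [zero_mul] at h0
    refine squeeze_zero_norm' ?_ h0
    filter_upwards [eventually_ge_atTop 0] with s hs
    rw [hG s hs, smul_smul, norm_smul, Real.norm_of_nonneg (by positivity)]
    gcongr
    exact (T s).le_of_opNorm_le (hM s hs) _
  have heq : ∀ s ∈ Ioi (0 : ℝ), (s ^ (k + 1) / ((k + 1).factorial : ℝ)) • -f s +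
      (s ^ k / (k.factorial : ℝ)) • G s = (s ^ k / k.factorial * Real.exp (-(ε * s))) • T s (V x) -
        (s ^ (k + 1) / (k + 1).factorial * Real.exp (-(ε * s))) • T s x := by
    intro s (hs : 0 < s)
    rw [hf s hs.le, hG s hs.le, smul_neg, smul_smul, smul_smul]
    abel
  have key := integral_Ioi_of_hasDerivAt_of_tendsto' (a := 0)
    (fun s _ => (hp s).smul (hd s))
    ((hi1.sub hi2).congr_fun (fun s hs => (heq s hs).symm) measurableSet_Ioi) hlim
  rw [setIntegral_congr_fun measurableSet_Ioi heq, integral_sub hi1 hi2] at key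
  rw [Pi.smul_apply', zero_pow k.succ_ne_zero, zero_div, zero_smul, sub_zero] at key
  exact (sub_eq_zero.1 key).symm

theorem IsStrongIntegral.integral_pow (hT : IsC0Semigroup T)
    (hM : ∀ t, 0 ≤ t → ‖T t‖ ≤ M) (hε : 0 < ε)
    (hV : IsStrongIntegral (fun s => Real.exp (-(ε * s))) T V) (k : ℕ) (x : X) :
    ∫ s in Ioi (0 : ℝ), (s ^ k / k.factorial * Real.exp (-(ε * s))) • T s x =
      (V ^ (k + 1)) x := by
  induction k generalizing x with
  | zero => simpa using (hV x).2.symm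
  | succ k ih => rw [hV.integral_pow_succ hT hM hε, ih, pow_succ _ (k + 1), mul_apply_eq_comp]

theorem IsStrongIntegral.exp_sub_one (hT : IsC0Semigroup T)
    (hM : ∀ t, 0 ≤ t → ‖T t‖ ≤ M) (hε : 0 < ε)
    (hV : IsStrongIntegral (fun s => Real.exp (-(ε * s))) T V) {t : ℝ} (ht : 0 ≤ t) :
    IsStrongIntegral (fun s => besselKernel t s * Real.exp (-(ε * s))) T
      (NormedSpace.exp ((t : 𝕜) • -V) - 1) := by
  intro x
  refine ⟨hT.integrableOn_smul hM (integrableOn_besselKernel_mul_exp hε ht) x, ?_⟩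
  have hM0 : 0 ≤ M := (norm_nonneg _).trans (hM 0 le_rfl)
  have h1 : HasSum (fun k => ∫ s in Ioi (0 : ℝ), besselKernelTerm ε t k s • T s x)
      (∫ s in Ioi (0 : ℝ), (besselKernel t s * Real.exp (-(ε * s))) • T s x) := by
    have hTm : AEStronglyMeasurable (fun s => T s x) (volume.restrict (Ioi 0)) :=
      ((hT.strongly_continuous x).mono Ioi_subset_Ici_self).aestronglyMeasurable measurableSet_Ioi
    have hsum := fun s => (hasSum_besselKernelMajorant ε t s).mul_right (M * ‖x‖)
    refine hasSum_integral_of_dominated_convergence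
      (fun k s => besselKernelMajorant ε t k s * (M * ‖x‖)) (fun k => ?_) (fun k => ?_)
      (ae_of_all _ fun s => (hsum s).summable) ?_ ?_
    · refine AEStronglyMeasurable.smul ?_ hTm
      unfold besselKernelTerm
      fun_prop
    · filter_upwards [ae_restrict_mem measurableSet_Ioi] with s (hs : 0 < s)
      rw [norm_smul]
      have := abs_besselKernelTerm_le hε ht hs.le k
      exact mul_le_mul this ((T s).le_of_opNorm_le (hM s hs.le) x) (norm_nonneg _)
        ((abs_nonneg _).trans this)
    · simp only [(hsum _).tsum_eq]
      exact ((integrableOn_exp_neg_mul (half_pos hε)).const_mul _).mul_const _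
    · filter_upwards [ae_restrict_mem measurableSet_Ioi] with s (hs : 0 < s)
      exact (hasSum_besselKernelTerm hε ht hs).smul_const _
  have h2 : HasSum (fun k => ∫ s in Ioi (0 : ℝ), besselKernelTerm ε t k s • T s x)
      ((NormedSpace.exp ((t : 𝕜) • -V) - 1) x) := by
    have h3 := hasSum_exp_smul_apply (-V) (t : 𝕜) x
    -- Dropping the zeroth term of the exponential series accounts for the `- 1`.
    rw [← hasSum_nat_add_iff' 1] at h3
    convert h3 using 1
    · funext k
      simp only [besselKernelTerm, mul_smul _ (_ * _), integral_smul]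
      rw [hV.integral_pow hT hM hε, RCLike.real_smul_eq_coe_smul (K := 𝕜),
        show (-V) ^ (k + 1) = (-1 : 𝕜) ^ (k + 1) • V ^ (k + 1) by rw [← smul_pow, neg_one_smul],
        smul_apply, smul_smul]
      congr 1
      push_cast
      ring
    · simp
  exact h2.unique h1

theorem IsC0Semigroup.exists_resolvent (hT : IsC0Semigroup T) (hM : ∀ t, 0 ≤ t → ‖T t‖ ≤ M)
    {A : X →ₗ.[𝕜] X} (hA : IsGenerator A T) (hε : 0 < ε) :
    ∃ R : X →L[𝕜] X, IsInverseOfSub A (ε : 𝕜) R ∧ (∀ x, ‖(ε : 𝕜) • R x‖ ≤ M * ‖x‖) ∧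
      ∀ t : ℝ, 0 ≤ t → IsStrongIntegral (fun s => besselKernel t s * Real.exp (-(ε * s))) T
        (NormedSpace.exp ((t : 𝕜) • R) - 1) := by
  obtain ⟨V, hV, hVn⟩ := hT.exists_isStrongIntegral hM (integrableOn_exp_neg_mul hε)
  refine ⟨-V, hV.isInverseOfSub hT hA, fun x => ?_, fun t ht => hV.exp_sub_one hT hM hε ht⟩
  have hint : ∫ s in Ioi (0 : ℝ), ‖Real.exp (-(ε * s))‖ = ε⁻¹ := by
    have := integral_exp_mul_Ioi (neg_lt_zero.2 hε) 0
    simpa [neg_div_neg_eq] using this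
  rw [hint] at hVn
  rw [norm_smul, neg_apply, norm_neg, RCLike.norm_ofReal, abs_of_pos hε]
  calc ε * ‖V x‖ ≤ ε * (ε⁻¹ * M * ‖x‖) := by gcongr; exact V.le_of_opNorm_le hVn x
    _ = M * ‖x‖ := by field_simp

end StrongIntegral

/-! ### Uniform bounds, the limit semigroup and its generator. -/

section Limit

variable {𝕜 X : Type*} [RCLike 𝕜] [NormedAddCommGroup X] [NormedSpace 𝕜 X]

theorem StronglyConvergesOnCompacts.uniformlyBoundedOnCompacts [CompleteSpace X]
    {E : ℕ → ℝ → X →L[𝕜] X} (hE : ∀ n x, Continuous fun t => E n t x)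
    (h : StronglyConvergesOnCompacts E) : UniformlyBoundedOnCompacts E := by
  intro K hK0 hK
  have key : ∀ x, ∃ C, ∀ p : ℕ × K, ‖E p.1 p.2 x‖ ≤ C := by
    intro x
    obtain ⟨u, hu⟩ := h x
    obtain ⟨N, hN⟩ := eventually_atTop.1 (Metric.tendstoUniformlyOn_iff.1 (hu K hK0 hK) 1 one_pos)
    choose c hc using fun n => hK.exists_bound_of_continuousOn (hE n x).continuousOn
    have hc' : ∀ n ≤ N, ∀ t ∈ K, ‖E n t x‖ ≤ ∑ i ∈ Finset.range (N + 1), |c i| := by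
      intro n hn t ht
      exact ((hc n t ht).trans (le_abs_self _)).trans (Finset.single_le_sum
        (f := fun i => |c i|) (fun i _ => abs_nonneg _) (Finset.mem_range.2 (Nat.lt_succ_of_le hn)))
    -- For `n ≥ N` both `E n t x` and `E N t x` lie within `1` of `u t`, hence the `2`.
    refine ⟨∑ i ∈ Finset.range (N + 1), |c i| + 2, fun ⟨n, t, ht⟩ => ?_⟩
    rcases le_total n N with hn | hn
    · linarith [hc' n hn t ht]
    · have h1 := hN n hn t ht
      have h2 := hN N le_rfl t ht
      have h3 := dist_triangle_left (E n t x) (E N t x) (u t)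
      rw [dist_eq_norm] at h3
      have h4 := norm_sub_norm_le (E n t x) (E N t x)
      linarith [hc' N le_rfl t ht]
  obtain ⟨C, hC⟩ := banach_steinhaus (g := fun p : ℕ × K => E p.1 p.2) key
  exact ⟨C, fun n t ht => hC (n, ⟨t, ht⟩)⟩

theorem UniformlyBoundedOnCompacts.sub_one_iff {E : ℕ → ℝ → X →L[𝕜] X} :
    UniformlyBoundedOnCompacts (fun n t => E n t - 1) ↔ UniformlyBoundedOnCompacts E := by
  constructor <;> intro h K hK0 hK <;> obtain ⟨C, hC⟩ := h K hK0 hK <;>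
    refine ⟨C + ‖(1 : X →L[𝕜] X)‖, fun n t ht => ?_⟩
  · rw [← sub_add_cancel (E n t) 1]
    exact (norm_add_le _ _).trans (by gcongr; exact hC n t ht)
  · exact (norm_sub_le _ _).trans (by gcongr; exact hC n t ht)

variable [NormedSpace ℝ X] [IsScalarTower ℝ 𝕜 X]

/-- Eigenvectors of the generator are eigenvectors of the semigroup. -/
theorem IsC0Semigroup.apply_eq_exp_smul {S : ℝ → X →L[𝕜] X} (hS : IsC0Semigroup S) {c : ℝ} {w : X}
    (hw : Tendsto (fun h : ℝ => h⁻¹ • (S h w - w)) (𝓝[>] 0) (𝓝 (c • w))) {t : ℝ} (ht : 0 ≤ t) :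
    S t w = Real.exp (c * t) • w := by
  have hd : ∀ r ∈ Ico 0 t, HasDerivWithinAt (fun r => S r w) (c • S r w) (Ici r) r := by
    intro r hr
    rw [← hasDerivWithinAt_Ioi_iff_Ici, hasDerivWithinAt_iff_tendsto_slope' (by simp)]
    have h1 : Tendsto (fun q : ℝ => q - r) (𝓝[>] r) (𝓝[>] 0) := by
      refine tendsto_nhdsWithin_iff.2 ⟨?_, ?_⟩
      · have : Tendsto (fun q : ℝ => q - r) (𝓝 r) (𝓝 (r - r)) := tendsto_id.sub_const r
        rw [sub_self] at this
        exact this.mono_left nhdsWithin_le_nhds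
      · filter_upwards [self_mem_nhdsWithin] with q (hq : r < q) using sub_pos.2 hq
    have h2 := ((S r).continuous.tendsto _).comp (hw.comp h1)
    rw [ContinuousLinearMap.map_smul_of_tower] at h2
    refine h2.congr' ?_
    filter_upwards [self_mem_nhdsWithin] with q (hq : r < q)
    have h3 := hS.map_add r (q - r) hr.1 (sub_pos.2 hq).le
    rw [add_sub_cancel] at h3
    simp [slope_def_module, ContinuousLinearMap.map_smul_of_tower, h3]
  have he : ∀ r : ℝ, HasDerivAt (fun r : ℝ => Real.exp (-(c * r))) (-c * Real.exp (-(c * r))) r := by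
    intro r
    have h : HasDerivAt (fun r : ℝ => -(c * r)) (-c) r := by
      simpa using ((hasDerivAt_id r).const_mul c).fun_neg
    rw [mul_comm]
    exact h.exp
  -- `e^{-cr} S(r)w` has zero right derivative, hence is constant.
  have hconst := constant_of_has_deriv_right_zero (a := 0) (b := t)
    (f := fun r => Real.exp (-(c * r)) • S r w) ?_ (fun r hr => ?_) t ⟨ht, le_rfl⟩
  · simp only [mul_zero, neg_zero, Real.exp_zero, one_smul, hS.map_zero,
      one_apply_eq_self] at hconst
    conv_rhs => rw [← hconst]
    rw [smul_smul, ← Real.exp_add, add_neg_cancel, Real.exp_zero, one_smul]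
  · exact ContinuousOn.smul (by fun_prop)
      ((hS.strongly_continuous w).mono Icc_subset_Ici_self)
  · refine ((he r).hasDerivWithinAt.smul (hd r hr)).congr_deriv ?_
    module

/-- By `hslope` the generator extends `A⁻¹`. Given `(x, y)` in its graph, the resolvent of `A` at
`1/c` solves `(c - A⁻¹)Az = cx - y`. Then `x - Az` satisfies the eigenvector equation for `c`, and
must vanish once `e^c > ‖S 1‖`. -/
theorem isGenerator_inverse_of_tendsto_exp {A : X →ₗ.[𝕜] X} (hinj : LinearMap.ker A.toFun = ⊥)
    (hsurj : ∀ μ : ℝ, 0 < μ → ∃ P : X →L[𝕜] X, IsInverseOfSub A (μ : 𝕜) P)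
    {S : ℝ → X →L[𝕜] X} (hS : IsC0Semigroup S)
    (hslope : ∀ z : A.domain, Tendsto (fun h : ℝ => h⁻¹ • (S h (A z) - A z)) (𝓝[>] 0) (𝓝 (z : X))) :
    IsGenerator A.inverse S := by
  intro x y
  constructor
  · intro h
    rw [LinearPMap.inverse_graph hinj] at h
    obtain ⟨⟨a, b⟩, hab, h⟩ := h
    obtain ⟨z, rfl, rfl⟩ := A.mem_graph_iff.1 hab
    obtain ⟨rfl, rfl⟩ := Prod.mk.inj h
    exact hslope z
  · intro h
    have hc : 0 < ‖S 1‖ + 1 := by positivity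
    set c := ‖S 1‖ + 1
    obtain ⟨P, hP⟩ := hsurj c⁻¹ (inv_pos.2 hc)
    let z : A.domain := ⟨P (c⁻¹ • (c • x - y)), hP.mem_domain _⟩
    have hz : A z - c⁻¹ • (z : X) = c⁻¹ • (c • x - y) := by
      have := hP.right_inv (c⁻¹ • (c • x - y))
      rwa [← RCLike.real_smul_eq_coe_smul (K := 𝕜)] at this
    have hz' : y - z = c • (x - A z) := by
      have := congrArg (c • ·) hz
      simp only [smul_sub, smul_inv_smul₀ hc.ne'] at this
      rw [smul_sub, sub_eq_sub_iff_add_eq_add]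
      rw [sub_eq_sub_iff_add_eq_add] at this
      rw [add_comm y, this, add_comm]
    have hw : Tendsto (fun h : ℝ => h⁻¹ • (S h (x - A z) - (x - A z))) (𝓝[>] 0)
        (𝓝 (c • (x - A z))) := by
      rw [← hz']
      refine (h.sub (hslope z)).congr fun h => ?_
      rw [← smul_sub, map_sub]
      congr 1
      abel
    have h0 : x - A z = 0 := by
      have h1 := hS.apply_eq_exp_smul hw zero_le_one
      have h2 := (S 1).le_opNorm (x - A z)
      rw [h1, norm_smul, Real.norm_of_nonneg (Real.exp_pos _).le, mul_one] at h2
      have h3 := Real.add_one_le_exp c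
      by_contra hne
      have h4 := le_of_mul_le_mul_right h2 (norm_pos_iff.2 hne)
      have h5 : ‖S 1‖ = c - 1 := (add_sub_cancel_right _ _).symm
      linarith
    rw [h0, smul_zero, sub_eq_zero] at hz'
    rw [sub_eq_zero.1 h0, hz']
    exact LinearPMap.mem_inverse_graph hinj z

variable [CompleteSpace X]

theorem stronglyConvergesOnCompacts_exp {R : ℕ → X →L[𝕜] X} (hR : ∀ m n, Commute (R m) (R n))
    {D : Set X} (hD : Dense D) (hRD : ∀ x ∈ D, CauchySeq fun n => R n x)
    (hb : UniformlyBoundedOnCompacts fun n t => NormedSpace.exp ((t : 𝕜) • R n)) :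
    StronglyConvergesOnCompacts fun n t => NormedSpace.exp ((t : 𝕜) • R n) := by
  have hbound : ∀ a : ℝ, ∃ C : ℝ, 0 < C ∧
      ∀ n, ∀ t ∈ Icc 0 a, ‖NormedSpace.exp ((t : 𝕜) • R n)‖ ≤ C := by
    intro a
    obtain ⟨C, hC⟩ := hb (Icc 0 a) Icc_subset_Ici_self isCompact_Icc
    exact ⟨|C| + 1, by positivity, fun n t ht => (hC n t ht).trans (by linarith [le_abs_self C])⟩
  have hcauchy : ∀ (a : ℝ) (x : X),
      UniformCauchySeqOn (fun n (t : ℝ) => NormedSpace.exp ((t : 𝕜) • R n) x) atTop (Icc 0 a) := by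
    intro a x
    obtain ⟨C, hC0, hC⟩ := hbound a
    rw [Metric.uniformCauchySeqOn_iff]
    intro δ hδ
    -- Each of the two terms in `x - d` costs `δ/4`; the difference at `d` costs `δ/2`.
    obtain ⟨d, hd, hxd⟩ := hD.exists_dist_lt x (show 0 < δ / (4 * C) by positivity)
    rw [dist_eq_norm, lt_div_iff₀ (by positivity)] at hxd
    obtain ⟨N, hN⟩ := Metric.cauchySeq_iff.1 (hRD d hd) (δ / (2 * (C * C * (|a| + 1))))
      (by positivity)
    refine ⟨N, fun m hm n hn t ht => ?_⟩
    have h1 := hN m hm n hn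
    rw [dist_eq_norm, lt_div_iff₀ (by positivity)] at h1
    have h2 := norm_exp_smul_sub_le (hR m n) ht.1
      (fun s hs => hC m s ⟨hs.1, hs.2.trans ht.2⟩) (fun s hs => hC n s ⟨hs.1, hs.2.trans ht.2⟩) d
    have h3 : C * C * ‖R m d - R n d‖ * t ≤ C * C * ‖R m d - R n d‖ * (|a| + 1) := by
      gcongr
      linarith [ht.2, le_abs_self a]
    have h4 := (NormedSpace.exp ((t : 𝕜) • R m)).le_of_opNorm_le (hC m t ht) (x - d)
    have h5 := (NormedSpace.exp ((t : 𝕜) • R n)).le_of_opNorm_le (hC n t ht) (x - d)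
    rw [dist_eq_norm]
    have h6 : NormedSpace.exp ((t : 𝕜) • R m) x - NormedSpace.exp ((t : 𝕜) • R n) x =
        NormedSpace.exp ((t : 𝕜) • R m) (x - d) - NormedSpace.exp ((t : 𝕜) • R n) (x - d) +
        (NormedSpace.exp ((t : 𝕜) • R m) d - NormedSpace.exp ((t : 𝕜) • R n) d) := by
      simp only [map_sub]
      abel
    rw [h6]
    refine (norm_add_le _ _).trans_lt ?_
    have h7 := norm_sub_le (NormedSpace.exp ((t : 𝕜) • R m) (x - d))
      (NormedSpace.exp ((t : 𝕜) • R n) (x - d))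
    linarith
  intro x
  have hlim : ∀ t : ℝ, ∃ y, 0 ≤ t →
      Tendsto (fun n => NormedSpace.exp ((t : 𝕜) • R n) x) atTop (𝓝 y) := by
    intro t
    by_cases ht : 0 ≤ t
    · obtain ⟨y, hy⟩ := cauchySeq_tendsto_of_complete
        ((hcauchy t x).cauchySeq (show t ∈ Icc 0 t from ⟨ht, le_rfl⟩))
      exact ⟨y, fun _ => hy⟩
    · exact ⟨0, fun h => absurd h ht⟩
  choose u hu using hlim
  refine ⟨u, fun K hK0 hK => ?_⟩
  obtain ⟨a, ha⟩ := hK.bddAbove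
  exact ((hcauchy a x).mono fun t ht => ⟨hK0 ht, ha ht⟩).tendstoUniformlyOn_of_tendsto
    fun t ht => hu t (hK0 ht)

/-- A strong limit, uniform on compacts, of uniformly continuous semigroups is a `C₀`-semigroup. -/
theorem StronglyConvergesOnCompacts.exists_isC0Semigroup {R : ℕ → X →L[𝕜] X}
    (h : StronglyConvergesOnCompacts fun n t => NormedSpace.exp ((t : 𝕜) • R n)) :
    ∃ S : ℝ → X →L[𝕜] X, IsC0Semigroup S ∧ ∀ x, ∀ K : Set ℝ, K ⊆ Ici 0 → IsCompact K →
      TendstoUniformlyOn (fun n (t : ℝ) => NormedSpace.exp ((t : 𝕜) • R n) x) (fun t => S t x)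
        atTop K := by
  have hcont := fun n x => continuous_exp_smul_apply (𝕜 := 𝕜) (R n) x
  have hb := h.uniformlyBoundedOnCompacts hcont
  choose u hu using h
  have hpt : ∀ t : ℝ, 0 ≤ t → ∀ x,
      Tendsto (fun n => NormedSpace.exp ((t : 𝕜) • R n) x) atTop (𝓝 (u x t)) := fun t ht x =>
    (hu x {t} (singleton_subset_iff.2 ht) isCompact_singleton).tendsto_at (mem_singleton t)
  have hS : ∀ t : ℝ, ∃ L : X →L[𝕜] X, 0 ≤ t → ∀ x, L x = u x t := by
    intro t
    by_cases ht : 0 ≤ t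
    · exact ⟨continuousLinearMapOfTendsto (fun n => NormedSpace.exp ((t : 𝕜) • R n))
        (f := fun x => u x t) (tendsto_pi_nhds.2 (hpt t ht)), fun _ _ => rfl⟩
    · exact ⟨0, fun h => absurd h ht⟩
  choose S hS using hS
  have hunif : ∀ x, ∀ K : Set ℝ, K ⊆ Ici 0 → IsCompact K →
      TendstoUniformlyOn (fun n (t : ℝ) => NormedSpace.exp ((t : 𝕜) • R n) x) (fun t => S t x)
        atTop K := fun x K hK0 hK =>
    (hu x K hK0 hK).congr_right fun t ht => (hS t (hK0 ht) x).symm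
  have hpt' : ∀ t : ℝ, 0 ≤ t → ∀ x,
      Tendsto (fun n => NormedSpace.exp ((t : 𝕜) • R n) x) atTop (𝓝 (S t x)) := fun t ht x => by
    rw [hS t ht x]
    exact hpt t ht x
  refine ⟨S, ⟨?_, fun s t hs ht => ?_, fun x t (ht : 0 ≤ t) => ?_⟩, hunif⟩
  · ext x
    refine tendsto_nhds_unique (hpt' 0 le_rfl x) ?_
    simp
  · ext x
    refine tendsto_nhds_unique (hpt' (s + t) (add_nonneg hs ht) x) ?_
    obtain ⟨C, hC⟩ := hb {s} (singleton_subset_iff.2 hs) isCompact_singleton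
    -- The bound at time `s` lets the product of two strongly convergent sequences pass to the
    -- limit.
    have h1 : Tendsto (fun n => NormedSpace.exp ((s : 𝕜) • R n)
        (NormedSpace.exp ((t : 𝕜) • R n) x - S t x)) atTop (𝓝 0) := by
      have h2 : Tendsto (fun n => C * ‖NormedSpace.exp ((t : 𝕜) • R n) x - S t x‖) atTop (𝓝 0) := by
        have := (tendsto_iff_norm_sub_tendsto_zero.1 (hpt' t ht x)).const_mul C
        rwa [mul_zero] at this
      exact squeeze_zero_norm (fun n => ContinuousLinearMap.le_of_opNorm_le _
        (hC n s (mem_singleton s)) _) h2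
    have h3 := h1.add (hpt' s hs (S t x))
    rw [zero_add] at h3
    refine h3.congr fun n => ?_
    rw [← map_add, sub_add_cancel, exp_smul_add, mul_apply_eq_comp]
  · have h1 : ContinuousOn (fun t => S t x) (Icc 0 (t + 1)) :=
      (hunif x _ Icc_subset_Ici_self isCompact_Icc).continuousOn
        (Frequently.of_forall fun n => (hcont n x).continuousOn)
    refine (h1 t ⟨ht, by linarith⟩).mono_of_mem_nhdsWithin ?_
    rw [← Ici_inter_Iic]
    exact inter_mem_nhdsWithin _ (Iic_mem_nhds (by linarith))

/-- For small `h` and all large `n`, `e^{sR_n}R_n x` stays within `3δ/4` of `y` on `[0, h]`.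
Integrating and letting `n → ∞` at fixed `h` bounds the slope error of `S` by `3δ/4 < δ`. -/
theorem tendsto_slope_of_tendstoUniformlyOn_exp {R : ℕ → X →L[𝕜] X} {S : ℝ → X →L[𝕜] X}
    (hb : UniformlyBoundedOnCompacts fun n t => NormedSpace.exp ((t : 𝕜) • R n))
    (hS : IsC0Semigroup S) (hRS : ∀ x, ∀ K : Set ℝ, K ⊆ Ici 0 → IsCompact K →
      TendstoUniformlyOn (fun n (t : ℝ) => NormedSpace.exp ((t : 𝕜) • R n) x) (fun t => S t x) atTop K)
    {x y : X} (hxy : Tendsto (fun n => R n x) atTop (𝓝 y)) :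
    Tendsto (fun h : ℝ => h⁻¹ • (S h x - x)) (𝓝[>] 0) (𝓝 y) := by
  obtain ⟨C, hC⟩ := hb (Icc 0 1) Icc_subset_Ici_self isCompact_Icc
  rw [Metric.tendsto_nhds]
  intro δ hδ
  have hcont := (hS.strongly_continuous y) 0 self_mem_Ici
  have hcont' := Metric.continuousWithinAt_iff.1 hcont (δ / 4) (by positivity)
  obtain ⟨r, hr, hSr⟩ := hcont'
  have hev1 := Metric.tendstoUniformlyOn_iff.1 (hRS y (Icc 0 1) Icc_subset_Ici_self isCompact_Icc)
    (δ / 4) (by positivity)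
  have hev2 : ∀ᶠ n in atTop, C * ‖R n x - y‖ < δ / 4 := by
    have := (tendsto_iff_norm_sub_tendsto_zero.1 hxy).const_mul C
    rw [mul_zero] at this
    exact this.eventually_lt_const (by positivity)
  filter_upwards [Ioo_mem_nhdsGT (show 0 < min r 1 by positivity)] with h hh
  have hhr : h < r := hh.2.trans_le (min_le_left _ _)
  have hh1 : h < 1 := hh.2.trans_le (min_le_right _ _)
  have hmain : ‖S h x - x - h • y‖ ≤ 3 * δ / 4 * h := by
    have hpt : Tendsto (fun n => NormedSpace.exp ((h : 𝕜) • R n) x) atTop (𝓝 (S h x)) :=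
      (hRS x {h} (singleton_subset_iff.2 hh.1.le) isCompact_singleton).tendsto_at
        (mem_singleton h)
    refine le_of_tendsto ((hpt.sub_const x).sub_const (h • y)).norm ?_
    filter_upwards [hev1, hev2] with n hn1 hn2
    refine norm_exp_smul_sub_sub_le (R n) hh.1.le x y fun s hs => ?_
    have hs1 : s ∈ Icc (0 : ℝ) 1 := ⟨hs.1, by linarith [hs.2]⟩
    have h1 := hn1 s hs1
    have h2 := (NormedSpace.exp ((s : 𝕜) • R n)).le_of_opNorm_le (hC n s hs1) (R n x - y)
    have h3 := hSr (x := s) hs.1 (by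
      rw [Real.dist_eq, sub_zero, abs_of_nonneg hs.1]
      exact hs.2.trans_lt hhr)
    rw [hS.map_zero, one_apply_eq_self, dist_eq_norm] at h3
    rw [dist_eq_norm, norm_sub_rev] at h1
    have h4 : NormedSpace.exp ((s : 𝕜) • R n) (R n x) - y =
        NormedSpace.exp ((s : 𝕜) • R n) (R n x - y) +
        (NormedSpace.exp ((s : 𝕜) • R n) y - S s y) + (S s y - y) := by
      rw [map_sub]
      abel
    rw [h4]
    linarith [norm_add₃_le (a := NormedSpace.exp ((s : 𝕜) • R n) (R n x - y))
      (b := NormedSpace.exp ((s : 𝕜) • R n) y - S s y) (c := S s y - y)]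
  have h5 : h⁻¹ • (S h x - x) - y = h⁻¹ • (S h x - x - h • y) := by
    rw [smul_sub h⁻¹ _ (h • y), inv_smul_smul₀ hh.1.ne']
  rw [dist_eq_norm, h5, norm_smul, norm_inv, Real.norm_of_nonneg hh.1.le, inv_mul_lt_iff₀ hh.1]
  nlinarith [hh.1, hmain]

end Limit

/-- The operators `R n = (A - ε n)⁻¹` and `B n t = ∫₀^∞ b_t(s) e^{-ε n s} T(s) ds` exist as bounded
operators (they are uniquely determined by the first two clauses), the two conditions are
equivalent, and either of them implies that `A⁻¹` generates the limit semigroup. -/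
theorem theorem2p1 {𝕜 X : Type*} [RCLike 𝕜] [NormedAddCommGroup X] [NormedSpace 𝕜 X]
    [NormedSpace ℝ X] [IsScalarTower ℝ 𝕜 X] [CompleteSpace X]
    (A : X →ₗ.[𝕜] X) (hinj : LinearMap.ker A.toFun = ⊥) (hdense : DenseRange A)
    (T : ℝ → X →L[𝕜] X) (hT : IsC0Semigroup T) (hTb : IsBoundedSemigroup T)
    (hA : IsGenerator A T)
    (ε : ℕ → ℝ) (hε : ∀ n, 0 < ε n) (hε0 : Tendsto ε atTop (𝓝 0)) :
    ∃ (R : ℕ → X →L[𝕜] X) (B : ℕ → ℝ → X →L[𝕜] X),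
      (∀ n, IsInverseOfSub A (ε n : 𝕜) (R n)) ∧
      (∀ n, ∀ t : ℝ, 0 ≤ t →
        IsStrongIntegral (fun s => besselKernel t s * Real.exp (-(ε n * s))) T (B n t)) ∧
      (UniformlyBoundedOnCompacts B ↔
        StronglyConvergesOnCompacts (fun n t => NormedSpace.exp ((t : 𝕜) • R n))) ∧
      (UniformlyBoundedOnCompacts B ∨
        StronglyConvergesOnCompacts (fun n t => NormedSpace.exp ((t : 𝕜) • R n)) →
        ∃ S : ℝ → X →L[𝕜] X, IsC0Semigroup S ∧ IsGenerator A.inverse S ∧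
          ∀ t : ℝ, 0 ≤ t → ∀ x : X,
            Tendsto (fun n => NormedSpace.exp ((t : 𝕜) • R n) x) atTop (𝓝 (S t x))) := by
  obtain ⟨M, hM⟩ := hTb
  choose R hR hRM hB using fun n => hT.exists_resolvent hM hA (hε n)
  have hiff : UniformlyBoundedOnCompacts
      (fun n (t : ℝ) => NormedSpace.exp ((t : 𝕜) • R n) - 1) ↔
      StronglyConvergesOnCompacts (fun n t => NormedSpace.exp ((t : 𝕜) • R n)) := by
    rw [UniformlyBoundedOnCompacts.sub_one_iff]
    refine ⟨stronglyConvergesOnCompacts_exp (fun m n => (hR m).commute (hR n)) hdense ?_,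
      fun h => h.uniformlyBoundedOnCompacts fun n x => continuous_exp_smul_apply (R n) x⟩
    rintro _ ⟨z, rfl⟩
    exact (tendsto_inverseOfSub_of_mem_range hdense hε0 hR hRM z).cauchySeq
  refine ⟨R, fun n t => NormedSpace.exp ((t : 𝕜) • R n) - 1, hR, hB, hiff, fun h => ?_⟩
  have hconv := h.elim hiff.1 id
  obtain ⟨S, hS, hRS⟩ := hconv.exists_isC0Semigroup
  refine ⟨S, hS, ?_, fun t ht x =>
    (hRS x {t} (singleton_subset_iff.2 ht) isCompact_singleton).tendsto_at (mem_singleton t)⟩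
  -- Resolvents are needed at every `μ > 0` here, not only at the `ε n`.
  refine isGenerator_inverse_of_tendsto_exp hinj
    (fun μ hμ => (hT.exists_resolvent hM hA hμ).imp fun _ h => h.1) hS fun z => ?_
  exact tendsto_slope_of_tendstoUniformlyOn_exp
    (UniformlyBoundedOnCompacts.sub_one_iff.1 (hiff.2 hconv)) hS hRS
    (tendsto_inverseOfSub_of_mem_range hdense hε0 hR hRM z)
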